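/- Let $\mathfrak A$ be a commutative unital $C^\star$-algebra and $M$ a smooth (finite-dimensional, Hausdorff, $\sigma$-compact) manifold. Let $C^\infty(M,\mathfrak A)$ be the ring of smooth $\mathfrak A$-valued functions on $M$, let $\mathfrak X(M)$ be the $C^\infty(M)$-module of smooth vector fields, and let \[ \mathfrak X(M)^{\mathfrak A}=\mathfrak X(M)\otimes_{C^\infty(M)}C^\infty(M,\mathfrak A) \] be the $C^\infty(M,\mathfrak A)$-module of smooth $\mathfrak A$-vector fields (smooth sections of the bundle with fibres $T_pM\otimes_{\mathbb R}\mathfrak A$). It acts on $C^\infty(M,\mathfrak A)$ by $(X\otimes h)(f)=h\cdot X(f)$, and carries the biadditive Lie bracket determined by \[ [X\otimes h,\,Y\otimes k]=[X,Y]\otimes(hk)+Y\otimes(h\,X(k))-X\otimes(k\,Y(h)). \] An $\mathfrak A$-connection on $M$ is a bilinear map $\nabla:\mathfrak X(M)^{\mathfrak A}\times\mathfrak X(M)^{\mathfrak A}\to\mathfrak X(M)^{\mathfrak A}$ with $\nabla_{f\tilde X}\tilde Y=f\nabla_{\tilde X}\tilde Y$ and $\nabla_{\tilde X}(f\tilde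 Y)=\tilde X(f)\tilde Y+f\nabla_{\tilde X}\tilde Y$ for all $f\in C^\infty(M,\mathfrak A)$; it is torsion-free if $\nabla_{\tilde X}\tilde Y-\nabla_{\tilde Y}\tilde X=[\tilde X,\tilde Y]$ for all $\tilde X,\tilde Y$. Its curvature is \[ \mathcal R(\tilde X,\tilde Y)\tilde Z=\nabla_{\tilde X}\nabla_{\tilde Y}\tilde Z-\nabla_{\tilde Y}\nabla_{\tilde X}\tilde Z-\nabla_{[\tilde X,\tilde Y]}\tilde Z, \] and the covariant derivative of $\mathcal R$ is \[ (\nabla_{\tilde X}\mathcal R)(\tilde Y,\tilde Z)\tilde W=\nabla_{\tilde X}\big(\mathcal R(\tilde Y,\tilde Z)\tilde W\big)-\mathcal R(\nabla_{\tilde X}\tilde Y,\tilde Z)\tilde W-\mathcal R(\tilde Y,\nabla_{\tilde X}\tilde Z)\tilde W-\mathcal R(\tilde Y,\tilde Z)\nabla_{\tilde X}\tilde W . \] **Proposition (Bianchi identities).** If $\mathcal R$ is the curvature of a torsion-free $\mathfrak A$-connection $\nabla$ on $M$, then for all $\tilde X,\tilde Y,\tilde Z\in\mathfrak X(M)^{\mathfrak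 A}$: (i) $\mathcal R(\tilde X,\tilde Y)\tilde Z+\mathcal R(\tilde Y,\tilde Z)\tilde X+\mathcal R(\tilde Z,\tilde X)\tilde Y=0$; (ii) $(\nabla_{\tilde X}\mathcal R)(\tilde Y,\tilde Z)\tilde W+(\nabla_{\tilde Y}\mathcal R)(\tilde Z,\tilde X)\tilde W+(\nabla_{\tilde Z}\mathcal R)(\tilde X,\tilde Y)\tilde W=0$ for every $\tilde W\in\mathfrak X(M)^{\mathfrak A}$. -/

import Mathlib

open scoped Manifold ContDiff TensorProduct

noncomputable section

namespace OperatorValued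

variable {E : Type*} [NormedAddCommGroup E] [NormedSpace ℝ E]
  {H : Type*} [TopologicalSpace H] (I : ModelWithCorners ℝ E H)
  (M : Type*) [TopologicalSpace M] [ChartedSpace H M]
  (A : Type*) [CommCStarAlgebra A]

/-- Multiplication and addition of a commutative unital `C⋆`-algebra are smooth, so that the
smooth `A`-valued functions form a commutative ring under pointwise operations. -/
instance instContMDiffRing : ContMDiffRing 𝓘(ℝ, A) ∞ A where
  contMDiff_mul := by
    have h : ContDiff ℝ ∞ (fun p : A × A => p.1 * p.2) := contDiff_mul
    rw [← modelWithCornersSelf_prod]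
    exact chartedSpaceSelf_prod (H := A) (H' := A) ▸ h.contMDiff

/-- The ring `C^∞(M)` of smooth real functions on `M`. -/
abbrev RealFun : Type _ := C^∞⟮I, M; 𝓘(ℝ, ℝ), ℝ⟯

/-- The ring `C^∞(M, A)` of smooth `A`-valued functions on `M`. -/
abbrev AFun : Type _ := C^∞⟮I, M; 𝓘(ℝ, A), A⟯

/-- The space `𝔛(M)` of smooth vector fields on `M`. -/
abbrev VField [IsManifold I ∞ M] : Type _ := Cₛ^∞⟮I; E, (TangentSpace I : M → Type _)⟯

variable {I M A}

instance instSMulCommClass : SMulCommClass (RealFun I M) (AFun I M A) (AFun I M A) where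
  smul_comm f g h := by
    ext x
    exact (mul_smul_comm (f x) (g x) (h x)).symm

theorem smul_mul_fun (r : RealFun I M) (g h : AFun I M A) : (r • g) * h = r • (g * h) := by
  ext x; exact smul_mul_assoc (r x) (g x) (h x)

theorem mul_smul_fun (r : RealFun I M) (g h : AFun I M A) : g * (r • h) = r • (g * h) := by
  ext x; exact mul_smul_comm (r x) (g x) (h x)

variable [IsManifold I ∞ M]

/-- `𝔛(M)` is a `C^∞(M)`-module under pointwise multiplication. -/
instance instModuleVField : Module (RealFun I M) (VField I M) where
  smul f X := ⟨fun x => f x • X x, f.contMDiff.smul_section X.contMDiff⟩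
  one_smul X := by ext x; exact one_smul ℝ (X x)
  mul_smul f g X := by ext x; exact mul_smul (f x) (g x) (X x)
  smul_zero f := by ext x; exact smul_zero (f x)
  smul_add f X Y := by ext x; exact smul_add (f x) (X x) (Y x)
  add_smul f g X := by ext x; exact add_smul (f x) (g x) (X x)
  zero_smul X := by ext x; exact zero_smul ℝ (X x)

/-- The derivative `X f` of a smooth function `f` with values in a normed space `F` (in particular
`F = ℝ` or `F = A`) along a smooth vector field `X`. -/
def VField.deriv {F : Type*} [NormedAddCommGroup F] [NormedSpace ℝ F] (X : VField I M)
    (f : C^∞⟮I, M; 𝓘(ℝ, F), F⟯) : C^∞⟮I, M; 𝓘(ℝ, F), F⟯ :=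
  ⟨fun x => mvfderiv I f x (X x), by
    have h1 : ContMDiff I.tangent 𝓘(ℝ, F).tangent ∞ (tangentMap I 𝓘(ℝ, F) f) :=
      f.contMDiff.contMDiff_tangentMap (by simp)
    exact (contMDiff_snd_tangentBundle_modelSpace F 𝓘(ℝ, F)).comp (h1.comp X.contMDiff)⟩

section
variable {F : Type*} [NormedAddCommGroup F] [NormedSpace ℝ F]

theorem VField.deriv_apply (X : VField I M) (f : C^∞⟮I, M; 𝓘(ℝ, F), F⟯) (x : M) :
    X.deriv f x = mvfderiv I f x (X x) := rfl

theorem VField.add_deriv (X Y : VField I M) (f : C^∞⟮I, M; 𝓘(ℝ, F), F⟯) :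
    (X + Y).deriv f = X.deriv f + Y.deriv f := by
  ext x
  exact map_add (mvfderiv I f x) (X x) (Y x)

theorem VField.smul_deriv (r : RealFun I M) (X : VField I M) (f : C^∞⟮I, M; 𝓘(ℝ, F), F⟯) :
    (r • X).deriv f = r • X.deriv f := by
  ext x
  exact map_smul (mvfderiv I f x) (r x) (X x)

theorem VField.deriv_add (X : VField I M) (f g : C^∞⟮I, M; 𝓘(ℝ, F), F⟯) :
    X.deriv (f + g) = X.deriv f + X.deriv g := by
  ext x
  simp only [VField.deriv_apply, ContMDiffMap.coe_add, Pi.add_apply]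
  rw [mvfderiv_add f.mdifferentiableAt g.mdifferentiableAt]
  rfl

theorem VField.deriv_smul (X : VField I M) (r : RealFun I M) (f : C^∞⟮I, M; 𝓘(ℝ, F), F⟯) :
    X.deriv (r • f) = r • X.deriv f + X.deriv r • f := by
  ext x
  have h := mvfderiv_smul (I := I) (x := x) r.mdifferentiableAt f.mdifferentiableAt
  have h2 := DFunLike.congr_fun h (X x)
  exact h2

end

/-- The Lie bracket `[X, Y]` of smooth vector fields. -/
def VField.bracket [FiniteDimensional ℝ E] (X Y : VField I M) : VField I M :=
  ⟨VectorField.mlieBracket I X Y, by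
    have h := ‹IsManifold I ∞ M›
    have : CompleteSpace E := FiniteDimensional.complete ℝ E
    have : IsManifold I (((⊤ : ℕ∞) : ℕ∞ω) + 1) M := h
    have : IsManifold I (minSmoothness ℝ 2) M := by
      rw [minSmoothness_of_isRCLikeNormedField]; exact IsManifold.of_le (n := ∞) (by decide)
    have : IsManifold I (minSmoothness ℝ 3) M := by
      rw [minSmoothness_of_isRCLikeNormedField]; exact IsManifold.of_le (n := ∞) (by decide)
    exact ContDiff.mlieBracket_vectorField (m := ⊤) (n := ⊤) X.contMDiff Y.contMDiff (by simp)⟩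

variable (I M A) in
/-- The `C^∞(M, A)`-module `𝔛(M)^A = 𝔛(M) ⊗_{C^∞(M)} C^∞(M, A)` of smooth `A`-vector fields,
that is of smooth sections of the bundle with fibres `T_p M ⊗_ℝ A`. The factor `C^∞(M, A)` is
written on the left, so that it acts by multiplication on that factor. -/
abbrev AField : Type _ := AFun I M A ⊗[RealFun I M] VField I M

/-- The simple `A`-vector field `X ⊗ h`, whose value at `p` is `X_p ⊗ h(p)`. -/
def VField.tensor (X : VField I M) (h : AFun I M A) : AField I M A := h ⊗ₜ[RealFun I M] X

theorem VField.add_bracket [FiniteDimensional ℝ E] (X Y Z : VField I M) :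
    (X + Y).bracket Z = X.bracket Z + Y.bracket Z := by
  ext x
  have : CompleteSpace E := FiniteDimensional.complete ℝ E
  have : IsManifold I 2 M := IsManifold.of_le (n := ∞) (by decide)
  exact VectorField.mlieBracket_add_left X.mdifferentiableAt Y.mdifferentiableAt

theorem VField.bracket_add [FiniteDimensional ℝ E] (X Y Z : VField I M) :
    X.bracket (Y + Z) = X.bracket Y + X.bracket Z := by
  ext x
  have : CompleteSpace E := FiniteDimensional.complete ℝ E
  have : IsManifold I 2 M := IsManifold.of_le (n := ∞) (by decide)
  exact VectorField.mlieBracket_add_right Y.mdifferentiableAt Z.mdifferentiableAt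

theorem VField.bracket_smul [FiniteDimensional ℝ E] (r : RealFun I M) (X Y : VField I M) :
    X.bracket (r • Y) = X.deriv r • Y + r • X.bracket Y := by
  ext x
  have : CompleteSpace E := FiniteDimensional.complete ℝ E
  have : IsManifold I 2 M := IsManifold.of_le (n := ∞) (by decide)
  exact VectorField.mlieBracket_smul_right r.mdifferentiableAt Y.mdifferentiableAt

theorem VField.smul_bracket [FiniteDimensional ℝ E] (r : RealFun I M) (X Y : VField I M) :
    (r • X).bracket Y = (-Y.deriv r) • X + r • X.bracket Y := by
  ext x
  have : CompleteSpace E := FiniteDimensional.complete ℝ E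
  have : IsManifold I 2 M := IsManifold.of_le (n := ∞) (by decide)
  exact VectorField.mlieBracket_smul_left r.mdifferentiableAt X.mdifferentiableAt

/-- The derivative `X̃ f` of `f ∈ C^∞(M, A)` along an `A`-vector field `X̃`, determined by
`(X ⊗ h) f = h · (X f)`. -/
def AField.deriv (X : AField I M A) (f : AFun I M A) : AFun I M A :=
  TensorProduct.lift
    (LinearMap.mk₂ (RealFun I M) (fun (h : AFun I M A) (X : VField I M) => h * X.deriv f)
      (fun h h' X => add_mul h h' (X.deriv f))
      (fun r h X => by ext x; exact smul_mul_assoc (r x) (h x) (X.deriv f x))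
      (fun h X Y => by rw [VField.add_deriv, mul_add])
      (fun r h X => by
        rw [VField.smul_deriv]; ext x; exact mul_smul_comm (r x) (h x) (X.deriv f x))) X

theorem addHom_ext {φ ψ : AField I M A →+ AField I M A}
    (h : ∀ (k : AFun I M A) (Y : VField I M), φ (Y.tensor k) = ψ (Y.tensor k)) : φ = ψ := by
  ext Z
  induction Z using TensorProduct.induction_on with
  | zero => simp
  | tmul k Y => exact h k Y
  | add Z Z' hZ hZ' => rw [map_add, map_add, hZ, hZ']

section bracket
variable [FiniteDimensional ℝ E]

/-- The formula `[X ⊗ h, Y ⊗ k] = [X, Y] ⊗ (h k) + Y ⊗ (h X(k)) - X ⊗ (k Y(h))` for the bracket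
of two simple `A`-vector fields. -/
def simpleBracket (h : AFun I M A) (X : VField I M) (k : AFun I M A) (Y : VField I M) :
    AField I M A :=
  (X.bracket Y).tensor (h * k) + Y.tensor (h * X.deriv k) - X.tensor (k * Y.deriv h)

theorem simpleBracket_add₁ (h h' : AFun I M A) (X : VField I M) (k : AFun I M A) (Y : VField I M) :
    simpleBracket (h + h') X k Y = simpleBracket h X k Y + simpleBracket h' X k Y := by
  simp only [simpleBracket, VField.tensor, VField.deriv_add, add_mul, mul_add,
    TensorProduct.add_tmul]
  abel

theorem simpleBracket_add₂ (h : AFun I M A) (X X' : VField I M) (k : AFun I M A) (Y : VField I M) :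
    simpleBracket h (X + X') k Y = simpleBracket h X k Y + simpleBracket h X' k Y := by
  simp only [simpleBracket, VField.tensor, VField.add_deriv, VField.add_bracket, mul_add,
    TensorProduct.add_tmul, TensorProduct.tmul_add]
  abel

theorem simpleBracket_add₃ (h : AFun I M A) (X : VField I M) (k k' : AFun I M A) (Y : VField I M) :
    simpleBracket h X (k + k') Y = simpleBracket h X k Y + simpleBracket h X k' Y := by
  simp only [simpleBracket, VField.tensor, VField.deriv_add, add_mul, mul_add,
    TensorProduct.add_tmul]
  abel

theorem simpleBracket_add₄ (h : AFun I M A) (X : VField I M) (k : AFun I M A) (Y Y' : VField I M) :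
    simpleBracket h X k (Y + Y') = simpleBracket h X k Y + simpleBracket h X k Y' := by
  simp only [simpleBracket, VField.tensor, VField.add_deriv, VField.bracket_add, mul_add,
    TensorProduct.add_tmul, TensorProduct.tmul_add]
  abel

theorem simpleBracket_smul_left (r : RealFun I M) (h : AFun I M A) (X : VField I M)
    (k : AFun I M A) (Y : VField I M) :
    simpleBracket (r • h) X k Y = simpleBracket h (r • X) k Y := by
  simp only [simpleBracket, VField.tensor, VField.deriv_smul, VField.smul_deriv,
    VField.smul_bracket, smul_mul_fun, mul_smul_fun, mul_add, TensorProduct.add_tmul,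
    TensorProduct.tmul_add, TensorProduct.smul_tmul', TensorProduct.tmul_smul, neg_smul,
    TensorProduct.tmul_neg, mul_comm k h]
  abel

theorem simpleBracket_smul_right (r : RealFun I M) (h : AFun I M A) (X : VField I M)
    (k : AFun I M A) (Y : VField I M) :
    simpleBracket h X (r • k) Y = simpleBracket h X k (r • Y) := by
  simp only [simpleBracket, VField.tensor, VField.deriv_smul, VField.smul_deriv,
    VField.bracket_smul, smul_mul_fun, mul_smul_fun, mul_add, TensorProduct.add_tmul,
    TensorProduct.tmul_add, TensorProduct.smul_tmul', TensorProduct.tmul_smul]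
  abel

/-- The bracket with a simple `A`-vector field. -/
def bracketSimple (h : AFun I M A) (X : VField I M) : AField I M A →+ AField I M A :=
  TensorProduct.liftAddHom
    (AddMonoidHom.mk' (fun k => AddMonoidHom.mk' (simpleBracket h X k) (simpleBracket_add₄ h X k))
      (fun k k' => by ext Y; exact simpleBracket_add₃ h X k k' Y))
    (fun r k Y => simpleBracket_smul_right r h X k Y)

theorem bracketSimple_tensor (h : AFun I M A) (X : VField I M) (k : AFun I M A) (Y : VField I M) :
    bracketSimple h X (Y.tensor k) = simpleBracket h X k Y := rfl

/-- `bracketSimple` as an additive map in the vector field. -/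
def bracketSimpleHom (h : AFun I M A) : VField I M →+ (AField I M A →+ AField I M A) where
  toFun := bracketSimple h
  map_zero' := by
    have H : bracketSimple h (0 + 0 : VField I M) = bracketSimple h 0 + bracketSimple h 0 :=
      addHom_ext fun k Y => simpleBracket_add₂ h 0 0 k Y
    rw [add_zero] at H
    exact left_eq_add.mp H
  map_add' X X' := addHom_ext fun k Y => simpleBracket_add₂ h X X' k Y

/-- The Lie bracket of `A`-vector fields: the biadditive extension of the formula on simple
fields. -/
def AField.bracketHom : AField I M A →+ (AField I M A →+ AField I M A) :=
  TensorProduct.liftAddHom (R := RealFun I M)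
    (AddMonoidHom.mk' (bracketSimpleHom (I := I) (M := M) (A := A)) (fun h h' => by
        ext1 X; exact addHom_ext fun k Y => simpleBracket_add₁ h h' X k Y))
    (fun r h X => addHom_ext fun k Y => simpleBracket_smul_left r h X k Y)

/-- The Lie bracket `[X̃, Ỹ]` of two `A`-vector fields. -/
def AField.bracket (X Y : AField I M A) : AField I M A := AField.bracketHom X Y

theorem AField.bracket_tensor (X Y : VField I M) (h k : AFun I M A) :
    AField.bracket (X.tensor h) (Y.tensor k) =
      (X.bracket Y).tensor (h * k) + Y.tensor (h * X.deriv k) - X.tensor (k * Y.deriv h) := rfl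

end bracket

variable (I M A) in
/-- An `A`-connection on `M`. Linearity over constant scalars in each argument follows from
additivity together with `smul_left` and `leibniz` for constant functions. -/
structure AConnection where
  /-- `∇ X̃ Ỹ` is the covariant derivative of `Ỹ` along `X̃`. -/
  nabla : AField I M A → AField I M A → AField I M A
  add_left : ∀ X X' Y, nabla (X + X') Y = nabla X Y + nabla X' Y
  add_right : ∀ X Y Y', nabla X (Y + Y') = nabla X Y + nabla X Y'
  smul_left : ∀ (f : AFun I M A) (X Y), nabla (f • X) Y = f • nabla X Y
  leibniz : ∀ (f : AFun I M A) (X Y), nabla X (f • Y) = AField.deriv X f • Y + f • nabla X Y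

namespace AConnection
variable (D : AConnection I M A)

/-- The covariant derivative `∇_X̃ T` of an operator `T` with three `A`-vector field arguments and
`A`-vector field values, for example a `(1,3)` `A`-tensor. -/
def covDeriv (T : AField I M A → AField I M A → AField I M A → AField I M A)
    (X Y Z W : AField I M A) : AField I M A :=
  D.nabla X (T Y Z W) - T (D.nabla X Y) Z W - T Y (D.nabla X Z) W - T Y Z (D.nabla X W)

variable [FiniteDimensional ℝ E]

/-- The torsion `T(X̃, Ỹ) = ∇_X̃ Ỹ - ∇_Ỹ X̃ - [X̃, Ỹ]`. -/
def torsion (X Y : AField I M A) : AField I M A :=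
  D.nabla X Y - D.nabla Y X - AField.bracket X Y

/-- An `A`-connection is torsion-free if its torsion vanishes. -/
def IsTorsionFree : Prop := ∀ X Y, D.torsion X Y = 0

/-- The curvature `R(X̃, Ỹ) Z̃ = ∇_X̃ ∇_Ỹ Z̃ - ∇_Ỹ ∇_X̃ Z̃ - ∇_[X̃, Ỹ] Z̃`. -/
def curvature (X Y Z : AField I M A) : AField I M A :=
  D.nabla X (D.nabla Y Z) - D.nabla Y (D.nabla X Z) - D.nabla (AField.bracket X Y) Z

end AConnection

end OperatorValued

end

namespace OperatorValued

variable {E : Type*} [NormedAddCommGroup E] [NormedSpace ℝ E]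
  {H : Type*} [TopologicalSpace H] {I : ModelWithCorners ℝ E H}
  {M : Type*} [TopologicalSpace M] [ChartedSpace H M] [IsManifold I ∞ M]
  {A : Type*} [CommCStarAlgebra A]

section deriv
variable {F : Type*} [NormedAddCommGroup F] [NormedSpace ℝ F]

theorem VField.deriv_mul (X : VField I M) (f g : AFun I M A) :
    X.deriv (f * g) = f * X.deriv g + g * X.deriv f := by
  ext x
  have h := (f.mdifferentiableAt (x := x)).hasMFDerivAt.mul
    (g.mdifferentiableAt (x := x)).hasMFDerivAt
  exact DFunLike.congr_fun h.mfderiv (X x)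

/-- The composition of a smooth vector-valued function with a continuous linear functional. -/
noncomputable def clmComp (φ : F →L[ℝ] ℝ) (f : C^∞⟮I, M; 𝓘(ℝ, F), F⟯) : RealFun I M :=
  ⟨fun x => φ (f x), φ.contMDiff.comp f.contMDiff⟩

theorem VField.deriv_clmComp (φ : F →L[ℝ] ℝ) (X : VField I M) (f : C^∞⟮I, M; 𝓘(ℝ, F), F⟯) :
    X.deriv (clmComp φ f) = clmComp φ (X.deriv f) := by
  ext x
  have h := φ.hasMFDerivAt.comp x (f.mdifferentiableAt (x := x)).hasMFDerivAt
  exact DFunLike.congr_fun h.mfderiv (X x)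

variable [FiniteDimensional ℝ E]

theorem VField.bracket_swap (X Y : VField I M) : X.bracket Y = -Y.bracket X := by
  ext x
  exact VectorField.mlieBracket_swap_apply

theorem VField.bracket_neg (X Y : VField I M) : X.bracket (-Y) = -X.bracket Y :=
  map_neg (AddMonoidHom.mk' X.bracket (VField.bracket_add X)) Y

theorem VField.bracket_leibniz (X Y Z : VField I M) :
    X.bracket (Y.bracket Z) = (X.bracket Y).bracket Z + Y.bracket (X.bracket Z) := by
  ext x
  have : CompleteSpace E := FiniteDimensional.complete ℝ E
  have : IsManifold I (minSmoothness ℝ 3) M := by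
    rw [minSmoothness_of_isRCLikeNormedField]; exact IsManifold.of_le (n := ∞) (by decide)
  have hle : minSmoothness ℝ 2 ≤ ∞ := by
    rw [minSmoothness_of_isRCLikeNormedField]; decide
  exact VectorField.leibniz_identity_mlieBracket_apply (X.contMDiff.of_le hle x)
    (Y.contMDiff.of_le hle x) (Z.contMDiff.of_le hle x)

/-- The commutator defect of the bracket, as a real function, annihilates every vector field. -/
theorem VField.bracket_deriv_defect_smul (X Y Z : VField I M) (f : RealFun I M) :
    ((X.bracket Y).deriv f - (X.deriv (Y.deriv f) - Y.deriv (X.deriv f))) • Z = 0 := by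
  have h := VField.bracket_leibniz X Y (f • Z)
  simp only [VField.bracket_smul, VField.bracket_add, VField.bracket_leibniz X Y Z] at h
  rw [← sub_eq_zero] at h
  rw [← neg_eq_zero, ← h]
  module

theorem VField.bracket_deriv_real (X Y : VField I M) (f : RealFun I M) :
    (X.bracket Y).deriv f = X.deriv (Y.deriv f) - Y.deriv (X.deriv f) := by
  ext x
  have key : ∀ Z : VField I M, Z x ≠ 0 →
      (X.bracket Y).deriv f x = (X.deriv (Y.deriv f) - Y.deriv (X.deriv f)) x := by
    intro Z hZ
    have h := DFunLike.congr_fun (VField.bracket_deriv_defect_smul X Y Z f) x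
    exact sub_eq_zero.mp ((smul_eq_zero.mp h).resolve_right hZ)
  by_cases hX : X x = 0
  · by_cases hY : Y x = 0
    · have hb : X.bracket Y x = 0 := by
        have h := VectorField.mlieBracketWithin_eq_zero_of_eq_zero (I := I) (s := Set.univ) hX hY
        exact h
      simp [VField.deriv_apply, hX, hY, hb]
    · exact key Y hY
  · exact key X hX

/-- The Lie bracket acts on vector-valued functions as the commutator of derivations. -/
theorem VField.bracket_deriv (X Y : VField I M) (f : C^∞⟮I, M; 𝓘(ℝ, F), F⟯) :
    (X.bracket Y).deriv f = X.deriv (Y.deriv f) - Y.deriv (X.deriv f) := by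
  ext x
  refine (SeparatingDual.eq_iff_forall_dual_eq (R := ℝ)).mpr fun φ => ?_
  have h := VField.bracket_deriv_real X Y (clmComp φ f)
  simp only [VField.deriv_clmComp] at h
  exact (DFunLike.congr_fun h x).trans
    (map_sub φ (X.deriv (Y.deriv f) x) (Y.deriv (X.deriv f) x)).symm

end deriv

section bracket

theorem VField.tensor_eq_smul (X : VField I M) (h : AFun I M A) :
    X.tensor h = h • X.tensor 1 := by
  simp [VField.tensor, TensorProduct.smul_tmul']

theorem VField.tensor_add (X Y : VField I M) (h : AFun I M A) :
    (X + Y).tensor h = X.tensor h + Y.tensor h := TensorProduct.tmul_add h X Y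

theorem VField.tensor_neg (X : VField I M) (h : AFun I M A) :
    (-X).tensor h = -X.tensor h := TensorProduct.tmul_neg h X

variable [FiniteDimensional ℝ E]

theorem AField.bracket_add (X Y Z : AField I M A) :
    X.bracket (Y + Z) = X.bracket Y + X.bracket Z := map_add (AField.bracketHom X) Y Z

theorem AField.add_bracket (X Y Z : AField I M A) :
    AField.bracket (X + Y) Z = X.bracket Z + Y.bracket Z :=
  DFunLike.congr_fun (map_add AField.bracketHom X Y) Z

theorem AField.bracket_sub (X Y Z : AField I M A) :
    X.bracket (Y - Z) = X.bracket Y - X.bracket Z := map_sub (AField.bracketHom X) Y Z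

theorem AField.sub_bracket (X Y Z : AField I M A) :
    AField.bracket (X - Y) Z = X.bracket Z - Y.bracket Z :=
  DFunLike.congr_fun (map_sub AField.bracketHom X Y) Z

@[simp]
theorem AField.bracket_zero (X : AField I M A) : X.bracket 0 = 0 :=
  map_zero (AField.bracketHom X)

@[simp]
theorem AField.zero_bracket (X : AField I M A) : AField.bracket 0 X = 0 :=
  DFunLike.congr_fun (map_zero AField.bracketHom) X

theorem AField.jacobi_tensor (X Y Z : VField I M) (h k l : AFun I M A) :
    AField.bracket (X.tensor h) (AField.bracket (Y.tensor k) (Z.tensor l)) +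
      AField.bracket (Y.tensor k) (AField.bracket (Z.tensor l) (X.tensor h)) +
      AField.bracket (Z.tensor l) (AField.bracket (X.tensor h) (Y.tensor k)) = 0 := by
  have hJ : Z.bracket (X.bracket Y) =
      -(X.bracket (Y.bracket Z) + Y.bracket (Z.bracket X)) := by
    rw [VField.bracket_swap, VField.bracket_leibniz X Y Z, VField.bracket_swap Z X,
      VField.bracket_neg]
    abel
  simp only [AField.bracket_tensor, AField.bracket_add, AField.bracket_sub, VField.deriv_mul,
    VField.bracket_deriv, hJ, VField.bracket_swap X Z, VField.bracket_swap Z Y,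
    VField.bracket_swap Y X, VField.tensor_add, VField.tensor_neg]
  simp only [VField.tensor_eq_smul _ (_ * _)]
  module

theorem AField.jacobi (X Y Z : AField I M A) :
    X.bracket (Y.bracket Z) + Y.bracket (Z.bracket X) + Z.bracket (X.bracket Y) = 0 := by
  induction X using TensorProduct.induction_on with
  | zero => simp
  | add X X' hX hX' =>
    simp only [AField.bracket_add, AField.add_bracket]
    rw [← add_zero (0 : AField I M A)]
    nth_rewrite 1 [← hX]
    rw [← hX']
    abel
  | tmul h X =>
    induction Y using TensorProduct.induction_on with
    | zero => simp
    | add Y Y' hY hY' =>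
      simp only [AField.bracket_add, AField.add_bracket]
      rw [← add_zero (0 : AField I M A)]
      nth_rewrite 1 [← hY]
      rw [← hY']
      abel
    | tmul k Y =>
      induction Z using TensorProduct.induction_on with
      | zero => simp
      | add Z Z' hZ hZ' =>
        simp only [AField.bracket_add, AField.add_bracket]
        rw [← add_zero (0 : AField I M A)]
        nth_rewrite 1 [← hZ]
        rw [← hZ']
        abel
      | tmul l Z => exact AField.jacobi_tensor X Y Z h k l

end bracket

namespace AConnection
variable (D : AConnection I M A)

theorem sub_left (X X' Y : AField I M A) : D.nabla (X - X') Y = D.nabla X Y - D.nabla X' Y :=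
  map_sub (AddMonoidHom.mk' (fun X => D.nabla X Y) fun X X' => D.add_left X X' Y) X X'

theorem sub_right (X Y Y' : AField I M A) : D.nabla X (Y - Y') = D.nabla X Y - D.nabla X Y' :=
  map_sub (AddMonoidHom.mk' (D.nabla X) (D.add_right X)) Y Y'

theorem zero_left (Y : AField I M A) : D.nabla 0 Y = 0 :=
  map_zero (AddMonoidHom.mk' (fun X => D.nabla X Y) fun X X' => D.add_left X X' Y)

variable [FiniteDimensional ℝ E] {D}

theorem IsTorsionFree.nabla_sub_nabla (hD : D.IsTorsionFree) (X Y : AField I M A) :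
    D.nabla X Y - D.nabla Y X = X.bracket Y := sub_eq_zero.mp (hD X Y)

theorem IsTorsionFree.bracket_swap (hD : D.IsTorsionFree) (X Y : AField I M A) :
    X.bracket Y = -Y.bracket X := by
  rw [← hD.nabla_sub_nabla, ← hD.nabla_sub_nabla, neg_sub]

theorem curvature_sub_left (X X' Y Z : AField I M A) :
    D.curvature (X - X') Y Z = D.curvature X Y Z - D.curvature X' Y Z := by
  simp only [curvature, sub_left, sub_right, AField.sub_bracket]
  abel

theorem IsTorsionFree.curvature_swap (hD : D.IsTorsionFree) (X Y Z : AField I M A) :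
    D.curvature X Y Z = -D.curvature Y X Z := by
  have h : D.nabla (-Y.bracket X) Z = -D.nabla (Y.bracket X) Z := by
    rw [← zero_sub, sub_left, zero_left, zero_sub]
  rw [curvature, curvature, hD.bracket_swap X Y, h]
  abel

/-- The first Bianchi identity. -/
theorem IsTorsionFree.bianchi_first (hD : D.IsTorsionFree) (X Y Z : AField I M A) :
    D.curvature X Y Z + D.curvature Y Z X + D.curvature Z X Y = 0 := by
  have hb : ∀ U V W : AField I M A, U.bracket (V.bracket W) =
      D.nabla U (D.nabla V W) - D.nabla U (D.nabla W V) - D.nabla (V.bracket W) U := fun U V W => by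
    rw [← hD.nabla_sub_nabla U, ← sub_right, hD.nabla_sub_nabla V W]
  rw [← AField.jacobi X Y Z]
  simp only [hb, curvature]
  abel

/-- The commutators of covariant differentiation with the curvature operators, corrected by the
Lie brackets, cancel cyclically. -/
theorem IsTorsionFree.cyclic_sum_nabla_curvature (hD : D.IsTorsionFree)
    (X Y Z W : AField I M A) :
    (D.nabla X (D.curvature Y Z W) - D.curvature Y Z (D.nabla X W) -
        D.curvature (X.bracket Y) Z W) +
      (D.nabla Y (D.curvature Z X W) - D.curvature Z X (D.nabla Y W) -
        D.curvature (Y.bracket Z) X W) +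
      (D.nabla Z (D.curvature X Y W) - D.curvature X Y (D.nabla Z W) -
        D.curvature (Z.bracket X) Y W) = 0 := by
  have h : D.nabla (AField.bracket (X.bracket Y) Z) W + D.nabla (AField.bracket (Y.bracket Z) X) W +
      D.nabla (AField.bracket (Z.bracket X) Y) W = 0 := by
    rw [← D.add_left, ← D.add_left, hD.bracket_swap (X.bracket Y), hD.bracket_swap (Y.bracket Z),
      hD.bracket_swap (Z.bracket X), ← D.zero_left W]
    congr 1
    rw [← neg_zero, ← AField.jacobi X Y Z]
    abel
  rw [← h]
  simp only [curvature, sub_right]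
  abel

/-- The second Bianchi identity. -/
theorem IsTorsionFree.bianchi_second (hD : D.IsTorsionFree) (X Y Z W : AField I M A) :
    D.covDeriv D.curvature X Y Z W + D.covDeriv D.curvature Y Z X W
      + D.covDeriv D.curvature Z X Y W = 0 := by
  rw [← hD.cyclic_sum_nabla_curvature X Y Z W]
  simp only [covDeriv, ← hD.nabla_sub_nabla, curvature_sub_left]
  rw [hD.curvature_swap Y (D.nabla X Z), hD.curvature_swap Z (D.nabla Y X),
    hD.curvature_swap X (D.nabla Z Y)]
  abel

end AConnection

end OperatorValued

/-- Both Bianchi identities for the curvature of a torsion-free `A`-connection on a smooth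
manifold; the second one is an identity of operators, evaluated at an arbitrary `W`. -/
theorem proposition4p3
    {E : Type*} [NormedAddCommGroup E] [NormedSpace ℝ E] [FiniteDimensional ℝ E]
    {H : Type*} [TopologicalSpace H] {I : ModelWithCorners ℝ E H}
    {M : Type*} [TopologicalSpace M] [ChartedSpace H M] [IsManifold I ∞ M]
    [T2Space M] [SigmaCompactSpace M]
    {A : Type*} [CommCStarAlgebra A]
    (D : OperatorValued.AConnection I M A) (hD : D.IsTorsionFree)
    (X Y Z : OperatorValued.AField I M A) :
    D.curvature X Y Z + D.curvature Y Z X + D.curvature Z X Y = 0 ∧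
    ∀ W : OperatorValued.AField I M A,
      D.covDeriv D.curvature X Y Z W + D.covDeriv D.curvature Y Z X W
        + D.covDeriv D.curvature Z X Y W = 0 := by
  exact ⟨hD.bianchi_first X Y Z, hD.bianchi_second X Y Z⟩
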